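/- Let $f:(0,\infty)\to[0,\infty)$. (1) Suppose $f$ is bounded. Put $w_k=f(k)$ and $W_n=\sum_{k=1}^n w_k$, and assume $W_n\to\infty$. If $X_1,X_2,\dots$ are i.i.d. exponential random variables with mean $1$, then the weighted strong law of large numbers holds: $$\frac1{W_n}\sum_{k=1}^n w_kX_k\longrightarrow 1\quad\text{almost surely as } n\to\infty .$$ (2) Suppose $f$ is monotone: either nonincreasing, or nondecreasing and bounded. Assume that $f$ is integrable on $(0,t]$ for every $t>0$ and that $\lambda_tf=\int_0^t f(x)\,dx\to\infty$ as $t\to\infty$. Let $(\Gamma_t)_{t\ge0}$ be a standard Gamma process, that is, $\Gamma_0=0$, the paths are nondecreasing and right-continuous, the increments are independent, and $\Gamma_t-\Gamma_s$ has the Gamma distribution with shape $t-s$ and rate $1$ for $s<t$ (so $\Gamma_1$ is exponential with mean $1$). Let $\Gamma_tf=\int_{(0,t]}f\,d\Gamma$ be the pathwise Lebesgue-Stieltjes integral. Then almost surely $\Gamma_tf$ is finite for all $t$, and $$R_t=\frac{\Gamma_tf}{\lambda_tf}\longrightarrow 1\quad\text{almost surely as } t\to\infty ;$$ also $R_t\to1$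 in probability (orderly divergence). -/

import Mathlib

open Set Filter Topology MeasureTheory ProbabilityTheory
open scoped NNReal ENNReal

/-- The standard Gamma process on `[0, ∞)`: it starts at `0`, its paths are nondecreasing and
right-continuous, its increments are independent, and `Γ t - Γ s` has the Gamma distribution with
shape `t - s` and rate `1` for `s < t` (so `Γ 1` is exponential with mean `1`). -/
structure IsGammaProcess {Ω : Type*} [MeasurableSpace Ω] (Γ : ℝ≥0 → Ω → ℝ)
    (μ : Measure Ω) : Prop where
  measurable : ∀ t, Measurable (Γ t)
  zero : ∀ ω, Γ 0 ω = 0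
  mono : ∀ ω, Monotone (fun t => Γ t ω)
  rightCts : ∀ ω t, ContinuousWithinAt (fun s => Γ s ω) (Ici t) t
  indep : HasIndepIncrements Γ μ
  law : ∀ s t : ℝ≥0, s < t →
    HasLaw (fun ω => Γ t ω - Γ s ω) (gammaMeasure ((t : ℝ) - (s : ℝ)) 1) μ

namespace IsGammaProcess

variable {Ω : Type*} [MeasurableSpace Ω] {Γ : ℝ≥0 → Ω → ℝ} {μ : Measure Ω}

/-- A path of the process, extended by the value `Γ 0 = 0` to the negative half-line. -/
def path (h : IsGammaProcess Γ μ) (ω : Ω) : StieltjesFunction ℝ where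
  toFun x := Γ x.toNNReal ω
  mono' := fun _ _ hxy => h.mono ω (Real.toNNReal_le_toNNReal hxy)
  right_continuous' := fun x =>
    (h.rightCts ω x.toNNReal).comp continuous_real_toNNReal.continuousWithinAt
      (fun _ hy => Real.toNNReal_le_toNNReal hy)

/-- The random measure `dΓ(ω)`: it gives `(s, t]` the mass `Γ t ω - Γ s ω`. -/
noncomputable def pathMeasure (h : IsGammaProcess Γ μ) (ω : Ω) : Measure ℝ :=
  (h.path ω).measure

/-- The pathwise Gamma integral `Γ_t f = ∫_(0,t] f dΓ`. -/
noncomputable def gammaIntegral (h : IsGammaProcess Γ μ) (f : ℝ → ℝ) (t : ℝ) (ω : Ω) : ℝ :=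
  ∫ x in Ioc 0 t, f x ∂(h.pathMeasure ω)

end IsGammaProcess

/-- `λ_t f = ∫_0^t f(x) dx`. -/
noncomputable def lam (f : ℝ → ℝ) (t : ℝ) : ℝ := ∫ x in Ioc 0 t, f x

/-- The ratio `R_t = Γ_t f / λ_t f`. -/
noncomputable def IsGammaProcess.ratio {Ω : Type*} [MeasurableSpace Ω] {Γ : ℝ≥0 → Ω → ℝ}
    {μ : Measure Ω} (h : IsGammaProcess Γ μ) (f : ℝ → ℝ) (t : ℝ) (ω : Ω) : ℝ :=
  h.gammaIntegral f t ω / lam f t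

/-- Orderly divergence: `R_t → 1` in probability as `t → ∞`. -/
def OrderlyDivergence {Ω : Type*} [MeasurableSpace Ω] {Γ : ℝ≥0 → Ω → ℝ}
    {μ : Measure Ω} (h : IsGammaProcess Γ μ) (f : ℝ → ℝ) : Prop :=
  TendstoInMeasure μ (fun t : ℝ => h.ratio f t) atTop (fun _ => (1 : ℝ))

/-- Orderly divergence in the almost sure mode: almost surely all the integrals `Γ_t f` are
finite, and `R_t → 1` as `t → ∞`. -/
def OrderlyDivergenceAS {Ω : Type*} [MeasurableSpace Ω] {Γ : ℝ≥0 → Ω → ℝ}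
    {μ : Measure Ω} (h : IsGammaProcess Γ μ) (f : ℝ → ℝ) : Prop :=
  ∀ᵐ ω ∂μ, (∀ t : ℝ, IntegrableOn f (Ioc 0 t) (h.pathMeasure ω)) ∧
    Tendsto (fun t : ℝ => h.ratio f t ω) atTop (𝓝 1)

/-- The weights `w_k = f(k)`, `k ≥ 1`; the `k`-th weight is stored at index `k - 1`. -/
def sampledWeights (f : ℝ → ℝ) (k : ℕ) : ℝ := f ((k : ℝ) + 1)

/-- `W_n = w_1 + ⋯ + w_n`, with `w_k` stored at index `k - 1`. -/
noncomputable def totalWeight (w : ℕ → ℝ) (n : ℕ) : ℝ := ∑ k ∈ Finset.range n, w k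

/-- The weighted discrete strong law `(w_1 X_1 + ⋯ + w_n X_n) / W_n → 1` almost surely,
with `w_k` and `X_k` stored at index `k - 1`. -/
def WeightedDiscreteSLLN {Ω : Type*} [MeasurableSpace Ω] (μ : Measure Ω)
    (w : ℕ → ℝ) (X : ℕ → Ω → ℝ) : Prop :=
  ∀ᵐ ω ∂μ, Tendsto (fun n : ℕ => (∑ k ∈ Finset.range n, w k * X k ω) / totalWeight w n)
    atTop (𝓝 1)

/-! For weights in `[0, C]`, the sum `S_n = ∑ w_k X_k` has mean `W_n` and variance `∑ w_k² ≤ C W_n`.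
At the first time `N_j` when `W` reaches `j²`, the second moment of `S / W - 1` is at most `C / j²`,
which is summable, so `S / W → 1` almost surely along `N_j`. Since `S` and `W` are monotone and `(j
+ 1)² / j² → 1`, the gaps fill in. Pairwise independence suffices
(`weightedDiscreteSLLN_of_bounded`).

For the Gamma process, the increments over `(k + 1, k + 2]` are i.i.d. exponential. Monotonicity
puts `f` between its endpoint values there, and the two resulting weight sums differ by a bounded
telescoping amount. So `Γ_t f` and `λ_t f` are both trapped between weighted sums with equivalent
total weights (`orderlyDivergence_of_bracket`). The interval `(0, 1]` adds only an almost surely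
finite amount. When `f` blows up at `0`, this holds because the dyadic upper sums of `f` have finite
expectation under `dΓ`. -/

/-! ### Moments of the Gamma distribution. -/

/-- A form of `Γ(a + 1) = a Γ(a)`. Iterating it reduces both moments to the total mass of a Gamma
density. -/
lemma ofReal_mul_gammaPDF {a : ℝ} (ha : 0 < a) (x : ℝ) :
    ENNReal.ofReal x * gammaPDF a 1 x = ENNReal.ofReal a * gammaPDF (a + 1) 1 x := by
  rcases lt_or_ge x 0 with hx | hx
  · simp [gammaPDF_of_neg hx]
  · rw [gammaPDF_of_nonneg hx, gammaPDF_of_nonneg hx, ← ENNReal.ofReal_mul hx,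
      ← ENNReal.ofReal_mul ha.le]
    congr 1
    have hG := (Real.Gamma_pos_of_pos ha).ne'
    rw [Real.Gamma_add_one ha.ne', add_sub_cancel_right]
    rcases hx.eq_or_lt with rfl | hx
    · simp [Real.zero_rpow ha.ne']
    · rw [Real.rpow_sub_one hx.ne']
      simp only [Real.one_rpow]
      field_simp

lemma measurable_gammaPDF (a r : ℝ) : Measurable (gammaPDF a r) :=
  (measurable_gammaPDFReal a r).ennreal_ofReal

lemma lintegral_gammaMeasure {a r : ℝ} {g : ℝ → ℝ≥0∞} (hg : Measurable g) :
    ∫⁻ x, g x ∂(gammaMeasure a r) = ∫⁻ x, g x * gammaPDF a r x := by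
  rw [gammaMeasure, lintegral_withDensity_eq_lintegral_mul _ (measurable_gammaPDF a r) hg]
  simp [mul_comm]

lemma lintegral_ofReal_gammaMeasure {a : ℝ} (ha : 0 < a) :
    ∫⁻ x, ENNReal.ofReal x ∂(gammaMeasure a 1) = ENNReal.ofReal a := by
  rw [lintegral_gammaMeasure ENNReal.measurable_ofReal]
  simp_rw [ofReal_mul_gammaPDF ha]
  rw [lintegral_const_mul _ (measurable_gammaPDF _ _),
    lintegral_gammaPDF_eq_one (by linarith) one_pos, mul_one]

lemma lintegral_ofReal_sq_gammaMeasure {a : ℝ} (ha : 0 < a) :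
    ∫⁻ x, ENNReal.ofReal x ^ 2 ∂(gammaMeasure a 1)
      = ENNReal.ofReal a * ENNReal.ofReal (a + 1) := by
  rw [lintegral_gammaMeasure (ENNReal.measurable_ofReal.pow_const 2)]
  simp_rw [pow_two, mul_assoc, ofReal_mul_gammaPDF ha, mul_left_comm (ENNReal.ofReal _) (ENNReal.ofReal a),
    ofReal_mul_gammaPDF (add_pos ha one_pos)]
  rw [lintegral_const_mul _ ((measurable_gammaPDF _ _).const_mul _),
    lintegral_const_mul _ (measurable_gammaPDF _ _),
    lintegral_gammaPDF_eq_one (by linarith) one_pos, mul_one]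

lemma ae_nonneg_gammaMeasure (a r : ℝ) : ∀ᵐ x ∂(gammaMeasure a r), 0 ≤ x := by
  rw [ae_iff, gammaMeasure, withDensity_apply _ (by measurability)]
  simpa [← Iio_def] using lintegral_gammaPDF_of_nonpos (a := a) (r := r) le_rfl

section Moments

variable {Ω : Type*} [MeasurableSpace Ω] {μ : Measure Ω} {X : Ω → ℝ} {a : ℝ}

lemma ProbabilityTheory.HasLaw.ae_nonneg_of_gamma {r : ℝ} (hX : HasLaw X (gammaMeasure a r) μ) :
    ∀ᵐ ω ∂μ, 0 ≤ X ω :=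
  (hX.ae_iff (p := fun x => 0 ≤ x) (by fun_prop)).2 (ae_nonneg_gammaMeasure a r)

lemma ProbabilityTheory.HasLaw.lintegral_ofReal_of_gamma (ha : 0 < a) (hX : HasLaw X (gammaMeasure a 1) μ) :
    ∫⁻ ω, ENNReal.ofReal (X ω) ∂μ = ENNReal.ofReal a := by
  rw [← lintegral_ofReal_gammaMeasure ha, ← hX.map_eq,
    lintegral_map' ENNReal.measurable_ofReal.aemeasurable hX.aemeasurable]

lemma ProbabilityTheory.HasLaw.integral_of_gamma (ha : 0 < a) (hX : HasLaw X (gammaMeasure a 1) μ) :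
    ∫ ω, X ω ∂μ = a := by
  rw [integral_eq_lintegral_of_nonneg_ae (HasLaw.ae_nonneg_of_gamma hX)
    hX.aemeasurable.aestronglyMeasurable, HasLaw.lintegral_ofReal_of_gamma ha hX,
    ENNReal.toReal_ofReal ha.le]

lemma ProbabilityTheory.HasLaw.lintegral_enorm_sq_of_gamma (ha : 0 < a) (hX : HasLaw X (gammaMeasure a 1) μ) :
    ∫⁻ ω, ‖X ω‖ₑ ^ 2 ∂μ = ENNReal.ofReal (a * (a + 1)) := by
  rw [ENNReal.ofReal_mul ha.le, ← lintegral_ofReal_sq_gammaMeasure ha, ← hX.map_eq,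
    lintegral_map' (ENNReal.measurable_ofReal.pow_const 2).aemeasurable hX.aemeasurable]
  refine lintegral_congr_ae ?_
  filter_upwards [HasLaw.ae_nonneg_of_gamma hX] with ω hω
  rw [Real.enorm_of_nonneg hω]

lemma ProbabilityTheory.HasLaw.memLp_two_of_gamma (ha : 0 < a) (hX : HasLaw X (gammaMeasure a 1) μ) :
    MemLp X 2 μ := by
  refine ⟨hX.aemeasurable.aestronglyMeasurable, ?_⟩
  rw [eLpNorm_lt_top_iff_lintegral_rpow_enorm_lt_top (by norm_num) (by norm_num)]
  have := HasLaw.lintegral_enorm_sq_of_gamma ha hX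
  simp [this]

lemma ProbabilityTheory.HasLaw.variance_of_gamma [IsProbabilityMeasure μ] (ha : 0 < a)
    (hX : HasLaw X (gammaMeasure a 1) μ) : Var[X; μ] = a := by
  rw [variance_eq_sub (HasLaw.memLp_two_of_gamma ha hX), HasLaw.integral_of_gamma ha hX]
  have : μ[X ^ 2] = a * (a + 1) := by
    change ∫ ω, X ω ^ 2 ∂μ = _
    rw [integral_eq_lintegral_of_nonneg_ae (ae_of_all _ fun ω => sq_nonneg (X ω))
      (hX.aemeasurable.pow_const 2).aestronglyMeasurable]
    rw [← ENNReal.toReal_ofReal (by positivity : 0 ≤ a * (a + 1)),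
      ← HasLaw.lintegral_enorm_sq_of_gamma ha hX]
    congr 1
    refine lintegral_congr fun ω => ?_
    rw [← enorm_pow, Real.enorm_of_nonneg (sq_nonneg _)]
  rw [this]; ring

end Moments

/-! ### Passing from the square times to the full sequence. -/

lemma tendsto_div_add_one_sq {u : ℕ → ℝ} {C : ℝ} (h1 : ∀ j : ℕ, (j : ℝ) ^ 2 ≤ u j)
    (h2 : ∀ j : ℕ, u j ≤ (j : ℝ) ^ 2 + C) :
    Tendsto (fun j => u j / ((j : ℝ) + 1) ^ 2) atTop (𝓝 1) := by
  have hx : Tendsto (fun j : ℕ => 1 / ((j : ℝ) + 1)) atTop (𝓝 0) :=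
    tendsto_one_div_add_atTop_nhds_zero_nat
  have hl : Tendsto (fun j : ℕ => (1 - 1 / ((j : ℝ) + 1)) ^ 2) atTop (𝓝 1) := by
    simpa using (hx.const_sub 1).pow 2
  have hr : Tendsto (fun j : ℕ => (1 - 1 / ((j : ℝ) + 1)) ^ 2 + C * (1 / ((j : ℝ) + 1)) ^ 2)
      atTop (𝓝 1) := by
    simpa using hl.add ((hx.pow 2).const_mul C)
  refine tendsto_of_tendsto_of_tendsto_of_le_of_le hl hr (fun j => ?_) (fun j => ?_)
  · have : (1 - 1 / ((j : ℝ) + 1)) ^ 2 = (j : ℝ) ^ 2 / ((j : ℝ) + 1) ^ 2 := by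
      field_simp; ring
    simp only [this]
    gcongr
    exact h1 j
  · have : (1 - 1 / ((j : ℝ) + 1)) ^ 2 + C * (1 / ((j : ℝ) + 1)) ^ 2
        = ((j : ℝ) ^ 2 + C) / ((j : ℝ) + 1) ^ 2 := by
      field_simp; ring
    simp only [this]
    gcongr
    exact h2 j

/-- The first index at which `W` reaches the level `j ^ 2`. -/
noncomputable def squareTime (W : ℕ → ℝ) (j : ℕ) : ℕ := sInf {n | (j : ℝ) ^ 2 ≤ W n}

lemma le_squareTime {W : ℕ → ℝ} (hW : Tendsto W atTop atTop) (j : ℕ) :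
    (j : ℝ) ^ 2 ≤ W (squareTime W j) :=
  Nat.sInf_mem (s := {n | (j : ℝ) ^ 2 ≤ W n}) (hW.eventually_ge_atTop _).exists

lemma squareTime_le {W : ℕ → ℝ} {j n : ℕ} (h : (j : ℝ) ^ 2 ≤ W n) : squareTime W j ≤ n :=
  Nat.sInf_le h

/-- By minimality the preceding index is still below `j ^ 2`, so the overshoot is at most one step.
-/
lemma apply_squareTime_le {W : ℕ → ℝ} {C : ℝ} (hC : 0 ≤ C) (h0 : W 0 = 0)
    (hstep : ∀ n, W (n + 1) ≤ W n + C) (j : ℕ) : W (squareTime W j) ≤ (j : ℝ) ^ 2 + C := by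
  rcases h : squareTime W j with _ | m
  · rw [h0]; positivity
  · have : W m < (j : ℝ) ^ 2 := by
      by_contra! hm
      have := squareTime_le hm
      omega
    linarith [hstep m]

/-- A monotone sequence is equivalent to a monotone sequence with bounded steps as soon as it is
so along the times at which the latter reaches the perfect squares. -/
lemma tendsto_div_of_tendsto_squareTime {s W : ℕ → ℝ} {C : ℝ} (hC : 0 ≤ C) (hs : Monotone s)
    (hs0 : 0 ≤ s 0) (hW : Monotone W) (h0 : W 0 = 0) (hstep : ∀ n, W (n + 1) ≤ W n + C)
    (hWt : Tendsto W atTop atTop)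
    (h : Tendsto (fun j => s (squareTime W j) / W (squareTime W j)) atTop (𝓝 1)) :
    Tendsto (fun n => s n / W n) atTop (𝓝 1) := by
  have hspos : ∀ n, 0 ≤ s n := fun n => hs0.trans (hs (Nat.zero_le n))
  have hWpos : ∀ n, 0 ≤ W n := fun n => h0.symm.le.trans (hW (Nat.zero_le n))
  have hu1 := le_squareTime hWt
  have hu2 := apply_squareTime_le hC h0 hstep
  -- With `j = ⌊√(W n)⌋` and `N = squareTime W`, one has `N j ≤ n ≤ N (j + 1)` and `j² ≤ W n ≤ (j +
  -- 1)²`. Hence `s n / W n` lies between `s (N j) / (j + 1)²` and `s (N (j + 1)) / j²`.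
  have hL : Tendsto (fun j : ℕ => s (squareTime W j) / ((j : ℝ) + 1) ^ 2) atTop (𝓝 1) := by
    have := h.mul (tendsto_div_add_one_sq hu1 hu2)
    rw [mul_one] at this
    refine this.congr' ?_
    filter_upwards [eventually_ge_atTop 1] with j hj
    have : W (squareTime W j) ≠ 0 := by
      have := hu1 j
      have : (0 : ℝ) < (j : ℝ) ^ 2 := by positivity
      linarith
    field_simp
  have hR : Tendsto (fun j : ℕ => s (squareTime W (j + 1)) / (j : ℝ) ^ 2) atTop (𝓝 1) := by
    have h1 := hL.comp (tendsto_add_atTop_nat 1)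
    -- The factor is `((j + 2) / j)²`, since `hL` at `j + 1` has denominator `(j + 2)²`.
    have h2 : Tendsto (fun j : ℕ => (1 + 2 * (1 / (j : ℝ))) ^ 2) atTop (𝓝 1) := by
      simpa using ((tendsto_one_div_atTop_nhds_zero_nat (𝕜 := ℝ)).const_mul 2 |>.const_add 1).pow 2
    have := h1.mul h2
    rw [mul_one] at this
    refine this.congr' ?_
    filter_upwards [eventually_ge_atTop 1] with j hj
    have : (j : ℝ) ≠ 0 := by positivity
    simp only [Function.comp]
    push_cast
    field_simp
    ring
  have hj : Tendsto (fun n => ⌊√(W n)⌋₊) atTop atTop :=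
    tendsto_nat_floor_atTop.comp (Real.tendsto_sqrt_atTop.comp hWt)
  refine tendsto_of_tendsto_of_tendsto_of_le_of_le' (hL.comp hj) (hR.comp hj) ?_ ?_
  · filter_upwards [hWt.eventually_gt_atTop 0] with n hn
    simp only [Function.comp]
    set j := ⌊√(W n)⌋₊
    have h1 : (j : ℝ) ^ 2 ≤ W n := by
      rw [← Real.sq_sqrt (hWpos n)]; gcongr; exact Nat.floor_le (Real.sqrt_nonneg _)
    have h2 : W n ≤ ((j : ℝ) + 1) ^ 2 := by
      rw [← Real.sq_sqrt (hWpos n)]; gcongr; exact (Nat.lt_floor_add_one _).le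
    have h3 := hs (squareTime_le h1)
    have := hspos n
    gcongr
  · filter_upwards [hWt.eventually_gt_atTop 0, hj.eventually_ge_atTop 1] with n hn hn1
    simp only [Function.comp]
    set j := ⌊√(W n)⌋₊
    have h1 : (j : ℝ) ^ 2 ≤ W n := by
      rw [← Real.sq_sqrt (hWpos n)]; gcongr; exact Nat.floor_le (Real.sqrt_nonneg _)
    have h2 : W n < ((j : ℝ) + 1) ^ 2 := by
      rw [← Real.sq_sqrt (hWpos n)]; gcongr; exact Nat.lt_floor_add_one _
    have h3 : n ≤ squareTime W (j + 1) := by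
      by_contra! hlt
      have := hW hlt.le
      have := hu1 (j + 1)
      push_cast at this
      linarith
    have h4 := hs h3
    have := hspos n
    have := hspos (squareTime W (j + 1))
    have : (0 : ℝ) < (j : ℝ) ^ 2 := by positivity
    gcongr

lemma totalWeight_succ (w : ℕ → ℝ) (n : ℕ) : totalWeight w (n + 1) = totalWeight w n + w n :=
  Finset.sum_range_succ _ _

lemma monotone_totalWeight {w : ℕ → ℝ} (hw : ∀ k, 0 ≤ w k) : Monotone (totalWeight w) :=
  monotone_nat_of_le_succ fun n => by rw [totalWeight_succ]; linarith [hw n]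

/-! ### The weighted strong law. -/

section SLLN

variable {Ω : Type*} [MeasurableSpace Ω] {μ : Measure Ω}

/-- Random variables whose second moments are summable tend to `0` almost surely. -/
lemma ae_tendsto_zero_of_summable_sq {Y : ℕ → Ω → ℝ} (hY : ∀ j, AEMeasurable (Y j) μ)
    {c : ℕ → ℝ} (hc : Summable c) (h : ∀ᶠ j in atTop, ∫⁻ ω, ‖Y j ω‖ₑ ^ 2 ∂μ ≤ ENNReal.ofReal (c j)) :
    ∀ᵐ ω ∂μ, Tendsto (fun j => Y j ω) atTop (𝓝 0) := by
  obtain ⟨N, hN⟩ := eventually_atTop.1 h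
  have hfin : ∫⁻ ω, ∑' j, ‖Y (j + N) ω‖ₑ ^ 2 ∂μ ≠ ∞ := by
    rw [lintegral_tsum fun j => (hY _).enorm.pow_const 2]
    refine ne_top_of_le_ne_top ?_ (ENNReal.tsum_le_tsum fun j => hN (j + N) (by omega))
    exact ((summable_nat_add_iff N).2 hc).tsum_ofReal_ne_top
  filter_upwards [ae_lt_top' (AEMeasurable.tsum fun j => (hY _).enorm.pow_const 2) hfin]
    with ω hω
  have h1 := ENNReal.tendsto_atTop_zero_of_tsum_ne_top hω.ne
  have h2 := (ENNReal.continuous_rpow_const (y := 1 / 2)).tendsto _ |>.comp h1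
  rw [← tendsto_add_atTop_iff_nat N, tendsto_zero_iff_enorm_tendsto_zero]
  have h3 : ∀ x : ℝ≥0∞, (x ^ 2) ^ (1 / 2 : ℝ) = x := fun x => by
    rw [← ENNReal.rpow_natCast, ← ENNReal.rpow_mul]; norm_num
  simpa only [Function.comp_def, h3, ENNReal.zero_rpow_of_pos one_half_pos] using h2

/-- The weighted strong law of large numbers with bounded weights. -/
theorem weightedDiscreteSLLN_of_bounded [IsProbabilityMeasure μ] {w : ℕ → ℝ} {C : ℝ} (hw : ∀ k, 0 ≤ w k)
    (hwC : ∀ k, w k ≤ C) (hW : Tendsto (totalWeight w) atTop atTop) {X : ℕ → Ω → ℝ}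
    (hind : Pairwise fun i j => IndepFun (X i) (X j) μ)
    (hX : ∀ k, HasLaw (X k) (expMeasure 1) μ) : WeightedDiscreteSLLN μ w X := by
  have hC : 0 ≤ C := (hw 0).trans (hwC 0)
  set W := totalWeight w with hWdef
  let S : ℕ → Ω → ℝ := fun n ω => ∑ k ∈ Finset.range n, w k * X k ω
  have hmem : ∀ k, MemLp (X k) 2 μ := fun k => HasLaw.memLp_two_of_gamma one_pos (hX k)
  have hSmem : ∀ n, MemLp (S n) 2 μ := fun n =>
    memLp_finsetSum _ fun k _ => (hmem k).const_mul (w k)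
  have hmean : ∀ n, μ[S n] = W n := fun n => by
    simp only [S, hWdef, totalWeight]
    rw [integral_finsetSum _ fun k _ => ((hmem k).integrable one_le_two).const_mul _]
    refine Finset.sum_congr rfl fun k _ => ?_
    rw [integral_const_mul, HasLaw.integral_of_gamma one_pos (hX k), mul_one]
  have hvar : ∀ n, Var[S n; μ] ≤ C * W n := fun n => by
    have hS : S n = ∑ k ∈ Finset.range n, fun ω => w k * X k ω := by
      ext ω; simp [S]
    rw [hS, IndepFun.variance_sum (fun k _ => (hmem k).const_mul (w k))]
    · simp only [hWdef, totalWeight, Finset.mul_sum]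
      -- Termwise `w_k² ≤ C w_k`.
      refine Finset.sum_le_sum fun k _ => ?_
      rw [variance_const_mul, HasLaw.variance_of_gamma one_pos (hX k), mul_one, pow_two]
      exact mul_le_mul_of_nonneg_right (hwC k) (hw k)
    · intro i _ j _ hij
      exact (hind hij).comp (measurable_const_mul (w i)) (measurable_const_mul (w j))
  have hstep : ∀ n, W (n + 1) ≤ W n + C := fun n => by
    rw [hWdef, totalWeight_succ]; linarith [hwC n]
  have hW0 : W 0 = 0 := by simp [hWdef, totalWeight]
  let N := squareTime W
  have hN := le_squareTime hW
  have hconv : ∀ᵐ ω ∂μ, Tendsto (fun j => S (N j) ω / W (N j) - 1) atTop (𝓝 0) := by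
    have hsum : Summable fun j : ℕ => C * (1 / (j : ℝ) ^ 2) :=
      (Real.summable_one_div_nat_pow.2 one_lt_two).mul_left C
    refine ae_tendsto_zero_of_summable_sq (fun j => ?_) hsum ?_
    · exact ((hSmem _).1.aemeasurable.div_const _).sub_const _
    -- The bound fails at `j = 0`: there `0 / 0 - 1 = -1`, while `C * (1 / 0 ^ 2) = 0`.
    filter_upwards [eventually_ge_atTop 1] with j hj
    have hj2 : (0 : ℝ) < (j : ℝ) ^ 2 := by positivity
    have hWj : 0 < W (N j) := hj2.trans_le (hN j)
    have e : ∀ ω, ‖S (N j) ω / W (N j) - 1‖ₑ ^ 2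
        = ENNReal.ofReal ((W (N j))⁻¹ ^ 2 * (S (N j) ω - W (N j)) ^ 2) := fun ω => by
      rw [← enorm_pow, Real.enorm_of_nonneg (sq_nonneg _), ← mul_pow]
      congr 2
      field_simp
    simp_rw [e]
    have hint : Integrable (fun ω => (S (N j) ω - W (N j)) ^ 2) μ :=
      ((hSmem (N j)).sub (memLp_const _)).integrable_sq
    rw [← ofReal_integral_eq_lintegral_ofReal (hint.const_mul _)
      (ae_of_all _ fun ω => by positivity), integral_const_mul]
    refine ENNReal.ofReal_le_ofReal ?_
    have hv : ∫ ω, (S (N j) ω - W (N j)) ^ 2 ∂μ = Var[S (N j); μ] := by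
      rw [variance_eq_integral (hSmem _).1.aemeasurable, hmean]
    rw [hv]
    calc (W (N j))⁻¹ ^ 2 * Var[S (N j); μ] ≤ (W (N j))⁻¹ ^ 2 * (C * W (N j)) := by
          gcongr; exact hvar _
      _ = C * (1 / W (N j)) := by field_simp
      _ ≤ C * (1 / (j : ℝ) ^ 2) := by gcongr; exact hN j
  filter_upwards [hconv, ae_all_iff.2 fun k => HasLaw.ae_nonneg_of_gamma (hX k)] with ω hω hpos
  refine tendsto_div_of_tendsto_squareTime (s := fun n => S n ω) hC ?_ (by simp [S])
    (monotone_totalWeight hw) hW0 hstep hW ?_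
  · refine monotone_nat_of_le_succ fun n => ?_
    simp only [S, Finset.sum_range_succ]
    linarith [mul_nonneg (hw n) (hpos n)]
  · simpa using hω.add_const 1

end SLLN

/-- Sandwiching a family between subsequences of two almost surely convergent sequences gives
convergence almost surely and, without any measurability of the family, in measure. -/
lemma ae_tendsto_and_tendstoInMeasure_of_sandwich {Ω : Type*} [MeasurableSpace Ω] {μ : Measure Ω}
    [IsFiniteMeasure μ] {R : ℝ → Ω → ℝ} {lo hi : ℕ → Ω → ℝ} {c : ℝ} {m : ℝ → ℕ}
    (hm : Tendsto m atTop atTop)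
    (hlo : ∀ n, AEMeasurable (lo n) μ) (hhi : ∀ n, AEMeasurable (hi n) μ)
    (hlo1 : ∀ᵐ ω ∂μ, Tendsto (fun n => lo n ω) atTop (𝓝 c))
    (hhi1 : ∀ᵐ ω ∂μ, Tendsto (fun n => hi n ω) atTop (𝓝 c)) {T : ℝ}
    (hR : ∀ᵐ ω ∂μ, ∀ t ≥ T, lo (m t) ω ≤ R t ω ∧ R t ω ≤ hi (m t) ω) :
    (∀ᵐ ω ∂μ, Tendsto (fun t => R t ω) atTop (𝓝 c)) ∧
      TendstoInMeasure μ R atTop (fun _ => c) := by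
  constructor
  · filter_upwards [hlo1, hhi1, hR] with ω h1 h2 h3
    refine tendsto_of_tendsto_of_tendsto_of_le_of_le' (h1.comp hm) (h2.comp hm) ?_ ?_
    · filter_upwards [eventually_ge_atTop T] with t ht using (h3 t ht).1
    · filter_upwards [eventually_ge_atTop T] with t ht using (h3 t ht).2
  · intro ε hε
    have h1 := tendstoInMeasure_of_tendsto_ae (fun n => (hlo n).aestronglyMeasurable) hlo1 ε hε
    have h2 := tendstoInMeasure_of_tendsto_ae (fun n => (hhi n).aestronglyMeasurable) hhi1 ε hε
    have h3 := (h1.add h2).comp hm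
    rw [add_zero] at h3
    refine tendsto_of_tendsto_of_tendsto_of_le_of_le' tendsto_const_nhds h3
      (Eventually.of_forall fun _ => zero_le) ?_
    filter_upwards [eventually_ge_atTop T] with t ht
    refine le_trans (measure_mono_ae ?_) (measure_union_le _ _)
    filter_upwards [hR] with ω hω hmem
    obtain ⟨ha, hb⟩ := hω t ht
    change ε ≤ edist (R t ω) c at hmem
    change ε ≤ edist (lo (m t) ω) c ∨ ε ≤ edist (hi (m t) ω) c
    simp only [edist_dist, Real.dist_eq] at hmem ⊢
    -- On either side of `c`, the bound lying on that side is at least as far from `c` as `R t ω`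
    -- is.
    rcases le_total (R t ω) c with hc | hc
    · left
      refine hmem.trans (ENNReal.ofReal_le_ofReal ?_)
      rw [abs_of_nonpos (by linarith), abs_of_nonpos (by linarith)]
      linarith
    · right
      refine hmem.trans (ENNReal.ofReal_le_ofReal ?_)
      rw [abs_of_nonneg (by linarith), abs_of_nonneg (by linarith)]
      linarith

/-! ### Comparison of integrals with step sums. -/

section Bracket

variable {ν : Measure ℝ} [IsLocallyFiniteMeasure ν] {f : ℝ → ℝ} {a b : ℕ → ℝ}

/-- A measurable function with values in `[α, β]` on `(s, t]` is integrable there, and its integral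
is between the corresponding multiples of the measure of `(s, t]`. -/
lemma setIntegral_Ioc_bracket {s t α β : ℝ}
    (hmeas : AEMeasurable f (ν.restrict (Ioc s t)))
    (h : ∀ x ∈ Ioc s t, α ≤ f x ∧ f x ≤ β) :
    IntegrableOn f (Ioc s t) ν ∧ α * ν.real (Ioc s t) ≤ ∫ x in Ioc s t, f x ∂ν ∧
      ∫ x in Ioc s t, f x ∂ν ≤ β * ν.real (Ioc s t) := by
  have hfin : ν (Ioc s t) ≠ ∞ := measure_Ioc_lt_top.ne
  have hint : IntegrableOn f (Ioc s t) ν := by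
    have : IsFiniteMeasure (ν.restrict (Ioc s t)) := isFiniteMeasure_restrict.2 hfin
    refine Integrable.of_bound hmeas.aestronglyMeasurable (max |α| |β|) ?_
    filter_upwards [ae_restrict_mem measurableSet_Ioc] with x hx
    exact abs_le_max_abs_abs (h x hx).1 (h x hx).2
  have hc : ∀ c : ℝ, ∫ _ in Ioc s t, c ∂ν = c * ν.real (Ioc s t) := fun c => by
    rw [setIntegral_const, smul_eq_mul, mul_comm]
  refine ⟨hint, ?_, ?_⟩
  · rw [← hc]
    exact setIntegral_mono_on (integrableOn_const hfin) hint measurableSet_Ioc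
      fun x hx => (h x hx).1
  · rw [← hc]
    exact setIntegral_mono_on hint (integrableOn_const hfin) measurableSet_Ioc
      fun x hx => (h x hx).2

/-- The measure is left general so that the same bounds serve Lebesgue measure, for `lam f`, and the
path measures, for the Gamma integral. -/
lemma setIntegral_Ioc_sum_bracket (hmeas : AEMeasurable f (ν.restrict (Ioi 0)))
    (h1 : IntegrableOn f (Ioc 0 1) ν) (h1pos : 0 ≤ ∫ x in Ioc 0 1, f x ∂ν)
    (hab : ∀ (k : ℕ), ∀ x ∈ Ioc ((k : ℝ) + 1) (k + 2), a k ≤ f x ∧ f x ≤ b k) (n : ℕ) :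
    IntegrableOn f (Ioc 0 ((n : ℝ) + 1)) ν ∧
    ∑ k ∈ Finset.range n, a k * ν.real (Ioc ((k : ℝ) + 1) (k + 2))
      ≤ ∫ x in Ioc 0 ((n : ℝ) + 1), f x ∂ν ∧
    ∫ x in Ioc 0 ((n : ℝ) + 1), f x ∂ν ≤ ∫ x in Ioc 0 1, f x ∂ν +
      ∑ k ∈ Finset.range n, b k * ν.real (Ioc ((k : ℝ) + 1) (k + 2)) := by
  induction n with
  | zero => simpa using ⟨h1, h1pos⟩
  | succ n ih =>
    obtain ⟨i1, i2, i3⟩ := ih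
    have hsub : Ioc ((n : ℝ) + 1) (n + 2) ⊆ Ioi 0 := fun x hx =>
      lt_trans (by positivity) hx.1
    obtain ⟨j1, j2, j3⟩ := setIntegral_Ioc_bracket (hmeas.mono_set hsub) (hab n)
    have hun : Ioc 0 (((n + 1 : ℕ) : ℝ) + 1) = Ioc 0 ((n : ℝ) + 1) ∪ Ioc ((n : ℝ) + 1) (n + 2) := by
      rw [Ioc_union_Ioc_eq_Ioc (by positivity) (by linarith)]
      push_cast; congr 1; ring
    have hdis : Disjoint (Ioc 0 ((n : ℝ) + 1)) (Ioc ((n : ℝ) + 1) (n + 2)) :=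
      Ioc_disjoint_Ioc_of_le le_rfl
    rw [hun, setIntegral_union hdis measurableSet_Ioc i1 j1, Finset.sum_range_succ,
      Finset.sum_range_succ]
    exact ⟨i1.union j1, by linarith, by linarith⟩

end Bracket

/-! ### Path measures, unit increments and the bracketing theorem. -/

namespace IsGammaProcess

variable {Ω : Type*} [MeasurableSpace Ω] {Γ : ℝ≥0 → Ω → ℝ} {μ : Measure Ω}

instance (h : IsGammaProcess Γ μ) (ω : Ω) : IsLocallyFiniteMeasure (h.pathMeasure ω) :=
  inferInstanceAs (IsLocallyFiniteMeasure (h.path ω).measure)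

lemma pathMeasure_Ioc (h : IsGammaProcess Γ μ) (ω : Ω) (s t : ℝ) :
    h.pathMeasure ω (Ioc s t) = ENNReal.ofReal (Γ t.toNNReal ω - Γ s.toNNReal ω) :=
  (h.path ω).measure_Ioc s t

lemma pathMeasure_real_Ioc (h : IsGammaProcess Γ μ) (ω : Ω) {s t : ℝ} (hst : s ≤ t) :
    (h.pathMeasure ω).real (Ioc s t) = Γ t.toNNReal ω - Γ s.toNNReal ω := by
  rw [measureReal_def, pathMeasure_Ioc, ENNReal.toReal_ofReal]
  exact sub_nonneg.2 (h.mono ω (Real.toNNReal_le_toNNReal hst))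

lemma measurable_pathMeasure_real_Ioc (h : IsGammaProcess Γ μ) (s t : ℝ) :
    Measurable fun ω => (h.pathMeasure ω).real (Ioc s t) := by
  simp only [measureReal_def, pathMeasure_Ioc]
  exact ((h.measurable _).sub (h.measurable _)).ennreal_ofReal.ennreal_toReal

lemma lintegral_pathMeasure_Ioc (h : IsGammaProcess Γ μ) {s t : ℝ} (hs : 0 ≤ s) (hst : s < t) :
    ∫⁻ ω, h.pathMeasure ω (Ioc s t) ∂μ = ENNReal.ofReal (t - s) := by
  have hlaw := h.law s.toNNReal t.toNNReal ((Real.toNNReal_lt_toNNReal_iff (by linarith)).2 hst)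
  rw [Real.coe_toNNReal s hs, Real.coe_toNNReal t (hs.trans hst.le)] at hlaw
  simp only [pathMeasure_Ioc]
  exact hlaw.lintegral_ofReal_of_gamma (sub_pos.2 hst)

/-- The increments of a standard Gamma process over `(1, 2], (2, 3], …`. -/
lemma hasLaw_unit_increment (h : IsGammaProcess Γ μ) (k : ℕ) :
    HasLaw (fun ω => (h.pathMeasure ω).real (Ioc ((k : ℝ) + 1) (k + 2))) (expMeasure 1) μ := by
  have hlaw := h.law ((k : ℝ) + 1).toNNReal ((k : ℝ) + 2).toNNReal
    ((Real.toNNReal_lt_toNNReal_iff (by positivity)).2 (by linarith))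
  rw [Real.coe_toNNReal _ (by positivity), Real.coe_toNNReal _ (by positivity),
    show (k : ℝ) + 2 - (k + 1) = 1 by ring] at hlaw
  simp only [h.pathMeasure_real_Ioc _ (show (k : ℝ) + 1 ≤ k + 2 by linarith)]
  -- `expMeasure 1` unfolds to `gammaMeasure 1 1`.
  exact hlaw

lemma indepFun_unit_increment (h : IsGammaProcess Γ μ) :
    iIndepFun (fun (k : ℕ) ω => (h.pathMeasure ω).real (Ioc ((k : ℝ) + 1) (k + 2))) μ := by
  have hm : Monotone fun k : ℕ => ((k : ℝ) + 1).toNNReal := fun i j hij =>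
    Real.toNNReal_le_toNNReal (by gcongr)
  convert h.indep.nat hm using 3 with k ω
  rw [h.pathMeasure_real_Ioc _ (by linarith)]
  push_cast
  congr 3
  ring_nf

/-- If `f` is, up to a bounded total error, a step function on the unit intervals of `(1, ∞)`, and
the contribution of `(0, 1]` is finite, then the Gamma integrals of `f` diverge orderly. -/
theorem orderlyDivergence_of_bracket [IsProbabilityMeasure μ] (h : IsGammaProcess Γ μ) {f : ℝ → ℝ}
    (hf : ∀ x : ℝ, 0 < x → 0 ≤ f x)
    (hmeas : ∀ ν : Measure ℝ, AEMeasurable f (ν.restrict (Ioi 0)))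
    (hint : IntegrableOn f (Ioc 0 1)) (hlam : Tendsto (lam f) atTop atTop)
    -- A measurable majorant spares proving that the integral over `(0, 1]` is measurable in `ω`.
    {Z : Ω → ℝ} (hZm : AEMeasurable Z μ)
    (hZ : ∀ᵐ ω ∂μ, IntegrableOn f (Ioc 0 1) (h.pathMeasure ω) ∧
      ∫ x in Ioc 0 1, f x ∂(h.pathMeasure ω) ≤ Z ω)
    {a b : ℕ → ℝ} {C D : ℝ} (ha : ∀ k, 0 ≤ a k) (hb : ∀ k, b k ≤ C)
    (hab : ∀ (k : ℕ), ∀ x ∈ Ioc ((k : ℝ) + 1) (k + 2), a k ≤ f x ∧ f x ≤ b k)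
    (hD : ∀ n, totalWeight b n ≤ totalWeight a n + D) :
    OrderlyDivergenceAS h f ∧ OrderlyDivergence h f := by
  have hab' : ∀ k, a k ≤ b k := fun k => by
    have := hab k (k + 2) ⟨by linarith, le_rfl⟩
    linarith
  set z := ∫ x in Ioc 0 1, f x with hz
  have hnn : ∀ (ν : Measure ℝ) (t : ℝ), 0 ≤ ∫ x in Ioc 0 t, f x ∂ν := fun ν t =>
    setIntegral_nonneg measurableSet_Ioc fun x hx => hf x hx.1
  have hz0 : 0 ≤ z := hnn _ _
  have hmono : ∀ (ν : Measure ℝ) {s t : ℝ}, s ≤ t → IntegrableOn f (Ioc 0 t) ν →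
      ∫ x in Ioc 0 s, f x ∂ν ≤ ∫ x in Ioc 0 t, f x ∂ν := fun ν s t hst hi =>
    setIntegral_mono_set hi
      (by filter_upwards [ae_restrict_mem measurableSet_Ioc] with x hx using hf x hx.1)
      (Ioc_subset_Ioc_right hst).eventuallyLE
  have hvol : ∀ n : ℕ, IntegrableOn f (Ioc 0 ((n : ℝ) + 1)) ∧ totalWeight a n ≤ lam f (n + 1) ∧
      lam f (n + 1) ≤ z + totalWeight b n := fun n => by
    have := setIntegral_Ioc_sum_bracket (hmeas volume) hint hz0 hab n
    have e : ∀ k : ℝ, volume.real (Ioc (k + 1) (k + 2)) = 1 := fun k => by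
      rw [measureReal_def, Real.volume_Ioc, ENNReal.toReal_ofReal (by linarith)]; ring
    simp only [e, mul_one] at this
    exact this
  have hlamn : Tendsto (fun n : ℕ => lam f (n + 1)) atTop atTop :=
    hlam.comp (tendsto_atTop_add_const_right _ _ tendsto_natCast_atTop_atTop)
  have hA : Tendsto (totalWeight a) atTop atTop := by
    refine tendsto_atTop_mono (fun n => ?_)
      (tendsto_atTop_add_const_right _ (-(z + D)) hlamn)
    linarith [(hvol n).2.2, hD n]
  have hB : Tendsto (totalWeight b) atTop atTop :=
    tendsto_atTop_mono (fun n => Finset.sum_le_sum fun k _ => hab' k) hA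
  have hAB : ∀ n, totalWeight a n ≤ totalWeight b (n + 1) := fun n =>
    (Finset.sum_le_sum fun k _ => hab' k).trans
      (monotone_totalWeight (fun k => (ha k).trans (hab' k)) n.le_succ)
  have hBA : ∀ n, totalWeight b (n + 1) ≤ totalWeight a n + (D + C) := fun n => by
    rw [totalWeight_succ]; linarith [hD n, hb n]
  set X : ℕ → Ω → ℝ := fun k ω => (h.pathMeasure ω).real (Ioc ((k : ℝ) + 1) (k + 2)) with hXdef
  have hind : Pairwise fun i j => IndepFun (X i) (X j) μ := fun i j hij =>
    h.indepFun_unit_increment.indepFun hij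
  have hSa := weightedDiscreteSLLN_of_bounded ha (fun k => (hab' k).trans (hb k)) hA hind
    h.hasLaw_unit_increment
  have hSb := weightedDiscreteSLLN_of_bounded (fun k => (ha k).trans (hab' k)) hb hB hind
    h.hasLaw_unit_increment
  have hratio : Tendsto (fun n => totalWeight b (n + 1) / totalWeight a n) atTop (𝓝 1) := by
    have h0 : Tendsto (fun n => 1 + (D + C) / totalWeight a n) atTop (𝓝 1) := by
      simpa using (hA.const_div_atTop (D + C)).const_add 1
    refine tendsto_of_tendsto_of_tendsto_of_le_of_le' tendsto_const_nhds h0 ?_ ?_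
    · filter_upwards [hA.eventually_gt_atTop 0] with n hn
      rw [one_le_div hn]; exact hAB n
    · filter_upwards [hA.eventually_gt_atTop 0] with n hn
      rw [← div_self hn.ne', ← add_div]
      gcongr
      exact hBA n
  have hXm : ∀ k, Measurable (X k) := fun k => h.measurable_pathMeasure_real_Ioc _ _
  -- For `n + 1 ≤ t ≤ n + 2`, `lo` bounds the numerator at `n + 1` and the denominator at `n + 2`;
  -- `hi` does the reverse. Hence the index `n = ⌊t⌋₊ - 1` below.
  let lo : ℕ → Ω → ℝ := fun n ω =>
    (∑ k ∈ Finset.range n, a k * X k ω) / (z + totalWeight b (n + 1))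
  let hi : ℕ → Ω → ℝ := fun n ω =>
    (Z ω + ∑ k ∈ Finset.range (n + 1), b k * X k ω) / totalWeight a n
  have hlo : ∀ᵐ ω ∂μ, Tendsto (fun n => lo n ω) atTop (𝓝 1) := by
    filter_upwards [hSa] with ω hω
    have h0 : Tendsto (fun n => z / totalWeight a n + totalWeight b (n + 1) / totalWeight a n)
        atTop (𝓝 1) := by
      simpa using (hA.const_div_atTop z).add hratio
    have := hω.div h0 one_ne_zero
    rw [div_one] at this
    refine this.congr' ?_
    filter_upwards [hA.eventually_gt_atTop 0] with n hn
    have : 0 < totalWeight b (n + 1) := hn.trans_le (hAB n)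
    simp only [lo, Pi.div_apply]
    rw [← add_div, div_div_div_cancel_right₀ hn.ne']
  have hhi : ∀ᵐ ω ∂μ, Tendsto (fun n => hi n ω) atTop (𝓝 1) := by
    filter_upwards [hSb] with ω hω
    have h0 := (hA.const_div_atTop (Z ω)).add
      ((hω.comp (tendsto_add_atTop_nat 1)).mul hratio)
    rw [zero_add, mul_one] at h0
    refine h0.congr' ?_
    filter_upwards [hA.eventually_gt_atTop 0] with n hn
    have : 0 < totalWeight b (n + 1) := hn.trans_le (hAB n)
    simp only [hi, Function.comp]
    field_simp
  have hpath : ∀ᵐ ω ∂μ, ∀ n : ℕ, IntegrableOn f (Ioc 0 ((n : ℝ) + 1)) (h.pathMeasure ω) ∧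
      ∑ k ∈ Finset.range n, a k * X k ω ≤ h.gammaIntegral f (n + 1) ω ∧
      h.gammaIntegral f (n + 1) ω ≤ Z ω + ∑ k ∈ Finset.range n, b k * X k ω := by
    filter_upwards [hZ] with ω hω n
    obtain ⟨i1, i2, i3⟩ := setIntegral_Ioc_sum_bracket (hmeas (h.pathMeasure ω)) hω.1
      (hnn _ _) hab n
    exact ⟨i1, i2, i3.trans (by gcongr; exact hω.2)⟩
  obtain ⟨N, hN⟩ := eventually_atTop.1 (hA.eventually_gt_atTop 0)
  have hm : Tendsto (fun t : ℝ => ⌊t⌋₊ - 1) atTop atTop :=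
    (tendsto_sub_atTop_nat 1).comp tendsto_nat_floor_atTop
  have key := ae_tendsto_and_tendstoInMeasure_of_sandwich (μ := μ) (R := fun t => h.ratio f t)
    (lo := lo) (hi := hi) (c := 1) (T := (N : ℝ) + 1) hm
    (fun n => (Measurable.div_const
      (Finset.measurable_fun_sum _ fun k _ => (hXm k).const_mul _) _).aemeasurable)
    (fun n => (hZm.add
      (Finset.measurable_fun_sum _ fun k _ => (hXm k).const_mul _).aemeasurable).div_const _)
    hlo hhi ?_
  · refine ⟨?_, key.2⟩
    filter_upwards [key.1, hpath] with ω hω hp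
    refine ⟨fun t => ?_, hω⟩
    obtain ⟨n, hn⟩ := exists_nat_ge t
    exact (hp n).1.mono_set (Ioc_subset_Ioc_right (by linarith))
  · filter_upwards [hpath] with ω hp t ht
    have ht0 : 0 ≤ t := le_trans (by positivity) ht
    obtain ⟨n, hn⟩ : ∃ n, ⌊t⌋₊ = n + 1 := by
      have : N + 1 ≤ ⌊t⌋₊ := Nat.le_floor (by exact_mod_cast ht)
      exact ⟨⌊t⌋₊ - 1, by omega⟩
    have hnN : N ≤ n := by
      have : N + 1 ≤ ⌊t⌋₊ := Nat.le_floor (by exact_mod_cast ht)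
      omega
    have h1 : (n : ℝ) + 1 ≤ t := by
      have := Nat.floor_le ht0
      rw [hn] at this; exact_mod_cast this
    have h2 : t ≤ ((n + 1 : ℕ) : ℝ) + 1 := by
      have := (Nat.lt_floor_add_one t).le
      rw [hn] at this; exact this
    have hAn := hN n hnN
    have hG1 : h.gammaIntegral f (n + 1) ω ≤ h.gammaIntegral f t ω :=
      hmono _ h1 ((hp (n + 1)).1.mono_set (Ioc_subset_Ioc_right h2))
    have hG2 : h.gammaIntegral f t ω ≤ h.gammaIntegral f ((n + 1 : ℕ) + 1) ω :=
      hmono _ h2 (hp (n + 1)).1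
    have hl1 : lam f (n + 1) ≤ lam f t :=
      hmono _ h1 ((hvol (n + 1)).1.mono_set (Ioc_subset_Ioc_right h2))
    have hl2 : lam f t ≤ lam f ((n + 1 : ℕ) + 1) := hmono _ h2 (hvol (n + 1)).1
    have hlpos : 0 < lam f t := (hAn.trans_le (hvol n).2.1).trans_le hl1
    simp only [hn, Nat.add_sub_cancel]
    have hG0 : 0 ≤ h.gammaIntegral f t ω := hnn _ _
    constructor
    · exact div_le_div₀ hG0 ((hp n).2.1.trans hG1) hlpos (hl2.trans (hvol (n + 1)).2.2)
    · exact div_le_div₀ (hG0.trans (hG2.trans (hp (n + 1)).2.2)) (hG2.trans (hp (n + 1)).2.2) hAn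
        ((hvol n).2.1.trans hl1)

end IsGammaProcess

/-! ### Finiteness near the origin, by dyadic sums. -/

lemma iUnion_Ioc_half_pow :
    ⋃ n : ℕ, Ioc ((1 / 2 : ℝ) ^ (n + 1)) ((1 / 2) ^ n) = Ioc 0 1 := by
  ext x
  simp only [mem_iUnion]
  constructor
  · rintro ⟨n, h1, h2⟩
    exact ⟨lt_trans (by positivity) h1, h2.trans (pow_le_one₀ (by norm_num) (by norm_num))⟩
  · rintro ⟨h1, h2⟩
    obtain ⟨n, hn⟩ := exists_nat_pow_near_of_lt_one h1 h2 (by norm_num : (0 : ℝ) < 1 / 2)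
      (by norm_num)
    exact ⟨n, hn⟩

lemma antitone_half_pow : Antitone fun n : ℕ => (1 / 2 : ℝ) ^ n :=
  pow_right_anti₀ (by norm_num) (by norm_num)

/-- The dyadic upper sums of an integrable antitone function on `(0, 1]` are finite. -/
lemma tsum_dyadic_upper_ne_top {f : ℝ → ℝ} (hanti : AntitoneOn f (Ioi 0))
    (hint : IntegrableOn f (Ioc 0 1)) :
    ∑' n : ℕ, ENNReal.ofReal (f ((1 / 2) ^ (n + 1))) *
      ENNReal.ofReal ((1 / 2 : ℝ) ^ n - (1 / 2) ^ (n + 1)) ≠ ∞ := by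
  let I : ℕ → Set ℝ := fun n => Ioc ((1 / 2 : ℝ) ^ (n + 1)) ((1 / 2) ^ n)
  have hfin : ∑' n, ∫⁻ x in I n, ENNReal.ofReal (f x) ≠ ∞ := by
    have hdis : Pairwise (Function.onFun Disjoint I) :=
      antitone_half_pow.pairwise_disjoint_on_Ioc_succ
    rw [← lintegral_iUnion (fun _ => measurableSet_Ioc) hdis, iUnion_Ioc_half_pow]
    exact (Integrable.lintegral_lt_top hint).ne
  -- The value at `(1 / 2) ^ (n + 1)`, an upper bound on `I n`, is a lower bound on `I (n + 1)`,
  -- which is half as long. The upper sum is thus at most twice the shifted sum.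
  have hshift : ∑' n, ∫⁻ x in I (n + 1), ENNReal.ofReal (f x) ≠ ∞ :=
    ne_top_of_le_ne_top hfin
      (ENNReal.tsum_comp_le_tsum_of_injective (add_left_injective 1)
        fun n => ∫⁻ x in I n, ENNReal.ofReal (f x))
  refine ne_top_of_le_ne_top (ENNReal.mul_ne_top (ENNReal.ofNat_ne_top (n := 2)) hshift) ?_
  rw [← ENNReal.tsum_mul_left]
  refine ENNReal.tsum_le_tsum fun n => ?_
  have hle : ENNReal.ofReal (f ((1 / 2) ^ (n + 1))) * volume (I (n + 1))
      ≤ ∫⁻ x in I (n + 1), ENNReal.ofReal (f x) := by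
    rw [← setLIntegral_const]
    refine setLIntegral_mono' measurableSet_Ioc fun x hx => ENNReal.ofReal_le_ofReal ?_
    have hx0 : 0 < x := lt_trans (by positivity) hx.1
    exact hanti hx0 (show (0 : ℝ) < (1 / 2) ^ (n + 1) by positivity) hx.2
  refine le_trans (le_of_eq ?_) (mul_le_mul_right hle 2)
  rw [Real.volume_Ioc, mul_left_comm]
  congr 1
  rw [← ENNReal.ofReal_ofNat 2, ← ENNReal.ofReal_mul (by norm_num)]
  congr 1
  ring

namespace IsGammaProcess

variable {Ω : Type*} [MeasurableSpace Ω] {Γ : ℝ≥0 → Ω → ℝ} {μ : Measure Ω}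

/-- The Gamma integral over `(0, 1]` of an integrable antitone function is almost surely finite. -/
lemma exists_bound_integral_of_antitoneOn (h : IsGammaProcess Γ μ) {f : ℝ → ℝ}
    (hf : ∀ x : ℝ, 0 < x → 0 ≤ f x) (hanti : AntitoneOn f (Ioi 0))
    (hint : IntegrableOn f (Ioc 0 1)) :
    ∃ Z : Ω → ℝ, Measurable Z ∧ ∀ᵐ ω ∂μ, IntegrableOn f (Ioc 0 1) (h.pathMeasure ω) ∧
      ∫ x in Ioc 0 1, f x ∂(h.pathMeasure ω) ≤ Z ω := by
  let I : ℕ → Set ℝ := fun n => Ioc ((1 / 2 : ℝ) ^ (n + 1)) ((1 / 2) ^ n)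
  let G : Ω → ℝ≥0∞ := fun ω =>
    ∑' n : ℕ, ENNReal.ofReal (f ((1 / 2) ^ (n + 1))) * h.pathMeasure ω (I n)
  have hIm : ∀ n, Measurable fun ω => h.pathMeasure ω (I n) := fun n => by
    simp only [I, pathMeasure_Ioc]
    exact ((h.measurable _).sub (h.measurable _)).ennreal_ofReal
  have hGm : Measurable G := Measurable.tsum fun n => (hIm n).const_mul _
  have hGfin : ∫⁻ ω, G ω ∂μ ≠ ∞ := by
    simp only [G]
    rw [lintegral_tsum fun n => ((hIm n).const_mul _).aemeasurable]
    -- Expectation turns the mass of `I n` into its length, leaving the dyadic upper sum.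
    refine ne_of_eq_of_ne ?_ (tsum_dyadic_upper_ne_top hanti hint)
    refine tsum_congr fun n => ?_
    rw [lintegral_const_mul _ (hIm n), h.lintegral_pathMeasure_Ioc (by positivity)]
    exact pow_lt_pow_right_of_lt_one₀ (by norm_num) (by norm_num) n.lt_succ_self
  refine ⟨fun ω => (G ω).toReal, hGm.ennreal_toReal, ?_⟩
  filter_upwards [ae_lt_top hGm hGfin] with ω hω
  have hle : ∫⁻ x in Ioc 0 1, ENNReal.ofReal (f x) ∂(h.pathMeasure ω) ≤ G ω := by
    rw [← iUnion_Ioc_half_pow]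
    refine (lintegral_iUnion_le _ _).trans (ENNReal.tsum_le_tsum fun n => ?_)
    rw [← setLIntegral_const]
    refine setLIntegral_mono' measurableSet_Ioc fun x hx => ENNReal.ofReal_le_ofReal ?_
    have h0 : (0 : ℝ) < (1 / 2) ^ (n + 1) := by positivity
    exact hanti h0 (h0.trans hx.1) hx.1.le
  have hnn : 0 ≤ᵐ[(h.pathMeasure ω).restrict (Ioc 0 1)] f := by
    filter_upwards [ae_restrict_mem measurableSet_Ioc] with x hx using hf x hx.1
  have hmeas : AEStronglyMeasurable f ((h.pathMeasure ω).restrict (Ioc 0 1)) :=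
    (aemeasurable_restrict_of_antitoneOn measurableSet_Ioc
      (hanti.mono Ioc_subset_Ioi_self)).aestronglyMeasurable
  refine ⟨⟨hmeas, ?_⟩, ?_⟩
  · rw [hasFiniteIntegral_iff_ofReal hnn]
    exact hle.trans_lt hω
  · rw [integral_eq_lintegral_of_nonneg_ae hnn hmeas]
    exact ENNReal.toReal_mono hω.ne hle

theorem orderlyDivergence_of_antitoneOn [IsProbabilityMeasure μ] (h : IsGammaProcess Γ μ)
    {f : ℝ → ℝ} (hf : ∀ x : ℝ, 0 < x → 0 ≤ f x) (hanti : AntitoneOn f (Ioi 0))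
    (hint : IntegrableOn f (Ioc 0 1)) (hlam : Tendsto (lam f) atTop atTop) :
    OrderlyDivergenceAS h f ∧ OrderlyDivergence h f := by
  obtain ⟨Z, hZm, hZ⟩ := h.exists_bound_integral_of_antitoneOn hf hanti hint
  have hpos : ∀ k : ℕ, (0 : ℝ) < k + 1 := fun k => by positivity
  have hpos2 : ∀ k : ℕ, (0 : ℝ) < k + 2 := fun k => by positivity
  refine h.orderlyDivergence_of_bracket hf
    (fun ν => aemeasurable_restrict_of_antitoneOn measurableSet_Ioi hanti) hint hlam
    hZm.aemeasurable hZ (a := fun k => f (k + 2)) (b := fun k => f (k + 1)) (C := f 1) (D := f 1)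
    (fun k => hf _ (hpos2 k)) (fun k => hanti (mem_Ioi.2 one_pos) (hpos k) (by simp))
    (fun k x hx => ⟨hanti ((hpos k).trans hx.1) (hpos2 k) hx.2,
      hanti (hpos k) ((hpos k).trans hx.1) hx.1.le⟩) fun n => ?_
  -- The sums telescope to a gap `f 1 - f (n + 1) ≤ f 1`, whence `D = f 1`.
  have key : ∀ n : ℕ, totalWeight (fun k => f (k + 1)) n
      = totalWeight (fun k => f (k + 2)) n + (f 1 - f (n + 1)) := fun n => by
    induction n with
    | zero => simp [totalWeight]
    | succ n ih =>
      rw [totalWeight_succ, totalWeight_succ, ih]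
      push_cast
      rw [show (n : ℝ) + 1 + 1 = n + 2 by ring]
      ring
  rw [key]
  linarith [hf _ (hpos n)]

theorem orderlyDivergence_of_monotoneOn [IsProbabilityMeasure μ] (h : IsGammaProcess Γ μ)
    {f : ℝ → ℝ} (hf : ∀ x : ℝ, 0 < x → 0 ≤ f x) (hmono : MonotoneOn f (Ioi 0))
    (hbdd : BddAbove (f '' Ioi 0)) (hint : IntegrableOn f (Ioc 0 1))
    (hlam : Tendsto (lam f) atTop atTop) :
    OrderlyDivergenceAS h f ∧ OrderlyDivergence h f := by
  obtain ⟨M, hM⟩ := hbdd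
  have hfM : ∀ x : ℝ, 0 < x → f x ≤ M := fun x hx => hM (mem_image_of_mem f hx)
  have hpos : ∀ k : ℕ, (0 : ℝ) < k + 1 := fun k => by positivity
  have hpos2 : ∀ k : ℕ, (0 : ℝ) < k + 2 := fun k => by positivity
  have hmeas : ∀ ν : Measure ℝ, AEMeasurable f (ν.restrict (Ioi 0)) := fun ν =>
    aemeasurable_restrict_of_monotoneOn measurableSet_Ioi hmono
  refine h.orderlyDivergence_of_bracket hf hmeas hint hlam
    (Z := fun ω => M * (h.pathMeasure ω).real (Ioc 0 1))
    ((h.measurable_pathMeasure_real_Ioc 0 1).const_mul M).aemeasurable (ae_of_all _ fun ω => ?_)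
    (a := fun k => f (k + 1)) (b := fun k => f (k + 2)) (C := M) (D := M)
    (fun k => hf _ (hpos k)) (fun k => hfM _ (hpos2 k))
    (fun k x hx => ⟨hmono (hpos k) ((hpos k).trans hx.1) hx.1.le,
      hmono ((hpos k).trans hx.1) (hpos2 k) hx.2⟩) fun n => ?_
  · obtain ⟨i1, -, i3⟩ := setIntegral_Ioc_bracket (ν := h.pathMeasure ω) (α := 0) (β := M)
      ((hmeas (h.pathMeasure ω)).mono_set Ioc_subset_Ioi_self)
      (fun x (hx : x ∈ Ioc (0 : ℝ) 1) => ⟨hf x hx.1, hfM x hx.1⟩)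
    exact ⟨i1, i3⟩
  -- Here the gap is `f (n + 1) - f 1 ≤ M`, whence `D = M`.
  have key : ∀ n : ℕ, totalWeight (fun k => f (k + 2)) n
      = totalWeight (fun k => f (k + 1)) n + (f (n + 1) - f 1) := fun n => by
    induction n with
    | zero => simp [totalWeight]
    | succ n ih =>
      rw [totalWeight_succ, totalWeight_succ, ih]
      push_cast
      rw [show (n : ℝ) + 1 + 1 = n + 2 by ring]
      ring
  rw [key]
  linarith [hf 1 one_pos, hfM _ (hpos n)]

end IsGammaProcess

theorem mainTheorem7 {Ω : Type*} [MeasurableSpace Ω] (μ : Measure Ω) [IsProbabilityMeasure μ]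
    (f : ℝ → ℝ) (hf : ∀ x : ℝ, 0 < x → 0 ≤ f x) :
    (BddAbove (f '' Ioi 0) →
      Tendsto (totalWeight (sampledWeights f)) atTop atTop →
      ∀ X : ℕ → Ω → ℝ, iIndepFun X μ → (∀ k, HasLaw (X k) (expMeasure 1) μ) →
        WeightedDiscreteSLLN μ (sampledWeights f) X) ∧
    ((AntitoneOn f (Ioi 0) ∨ (MonotoneOn f (Ioi 0) ∧ BddAbove (f '' Ioi 0))) →
      (∀ t : ℝ, IntegrableOn f (Ioc 0 t)) →
      Tendsto (lam f) atTop atTop →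
      ∀ (Γ : ℝ≥0 → Ω → ℝ) (hΓ : IsGammaProcess Γ μ),
        OrderlyDivergenceAS hΓ f ∧ OrderlyDivergence hΓ f) := by
  constructor
  · rintro ⟨M, hM⟩ hW X hind hX
    have hpos : ∀ k : ℕ, (0 : ℝ) < k + 1 := fun k => by positivity
    exact weightedDiscreteSLLN_of_bounded (fun k => hf _ (hpos k))
      (fun k => hM (mem_image_of_mem f (hpos k))) hW (fun i j hij => hind.indepFun hij) hX
  · rintro (hanti | ⟨hmono, hbdd⟩) hint hlam Γ hΓ
    · exact hΓ.orderlyDivergence_of_antitoneOn hf hanti (hint 1) hlam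
    · exact hΓ.orderlyDivergence_of_monotoneOn hf hmono hbdd (hint 1) hlam
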